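/- Let $n\ge 2$, let $(X_k)_{k\ge1}$ be independent random variables uniformly distributed on $\{1,\dots,n\}$, let $T_n=\inf\{k\ge 1:\{X_1,\dots,X_k\}=\{1,\dots,n\}\}$ be the coupon collector's completion time, and put $Z_n=\frac{T_n}{n}-\log n$. Let $Z$ have the standard Gumbel distribution, i.e. the law on $\mathbb R$ with density $x\mapsto e^{-(x+e^{-x})}$. For $f:\mathbb R\to\mathbb R$ let $\|f\|_{\mathrm{Lip}}=\sup_{t\ne s}\frac{|f(t)-f(s)|}{|t-s|}$; let $\mathrm{Lip}_{[2]}(\mathbb R)$ be the set of all (possibly unbounded) Lipschitz functions $f$ on $\mathbb R$ whose derivative $f'$ exists and is Lipschitz, and let $\|f\|_{\mathrm{Lip}_{[2]}}=\max(\|f\|_{\mathrm{Lip}},\|f'\|_{\mathrm{Lip}})$. For probability measures $\mu,\nu$ on $\mathbb R$ that integrate every function of $\mathrm{Lip}_{[2]}(\mathbb R)$ put $$\operatorname{dist}_{\mathrm{Lip}_{[2]}}(\mu,\nu)=\sup\Big\{\int f\,d\mu-\int f\,d\nu \;:\; f\in\mathrm{Lip}_{[2]}(\mathbb R),\ \|f\|_{\mathrm{Lip}_{[2]}}=1\Big\}.$$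 **Theorem.** For every $n\ge2$, $T_n$ is almost surely finite and the laws of $Z_n$ and $Z$ integrate every function of $\mathrm{Lip}_{[2]}(\mathbb R)$. Moreover, there is a constant $C>0$ such that for all $n\ge 2$ $$\operatorname{dist}_{\mathrm{Lip}_{[2]}}\big(\operatorname{law}(Z_n),\operatorname{law}(Z)\big)\le C\,\frac{\log n}{n}.$$ -/

import Mathlib

open MeasureTheory ProbabilityTheory
open scoped ENNReal

namespace CouponCollector

/-- The Lipschitz seminorm `sup_{t ≠ s} |f t - f s| / |t - s|`, with value `∞` when `f` is not
Lipschitz. -/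
noncomputable def lipSeminorm (f : ℝ → ℝ) : ℝ≥0∞ :=
  ⨆ (s : ℝ) (t : ℝ) (_ : t ≠ s), ENNReal.ofReal (|f t - f s| / |t - s|)

/-- The class `Lip_[2](ℝ)` of Lipschitz functions (not necessarily bounded) whose derivative is
Lipschitz. A Lipschitz function is the integral of its a.e. derivative, so if the latter has a
Lipschitz representative then `f` is differentiable everywhere and `deriv f` is that
representative. -/
structure MemLipTwo (f : ℝ → ℝ) : Prop where
  lip : lipSeminorm f < ∞
  differentiable : Differentiable ℝ f
  lip_deriv : lipSeminorm (deriv f) < ∞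

/-- The seminorm of `Lip_[2](ℝ)`. -/
noncomputable def lipTwoSeminorm (f : ℝ → ℝ) : ℝ≥0∞ :=
  max (lipSeminorm f) (lipSeminorm (deriv f))

/-- The smooth Wasserstein distance
`sup {∫ f dμ - ∫ f dν : f ∈ Lip_[2](ℝ), ‖f‖ = 1}`; the supremum is taken in the extended reals,
so an unbounded family gives `∞`. It is meant for measures with a finite first moment, which
integrate every function of the class. -/
noncomputable def lipTwoDist (μ ν : Measure ℝ) : EReal :=
  ⨆ (f : ℝ → ℝ) (_ : MemLipTwo f) (_ : lipTwoSeminorm f = 1),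
    ((∫ x, f x ∂μ - ∫ x, f x ∂ν : ℝ) : EReal)

/-- The standard Gumbel distribution, with density `x ↦ exp (-(x + exp (-x)))`. -/
noncomputable def gumbel : Measure ℝ :=
  volume.withDensity fun x => ENNReal.ofReal (Real.exp (-(x + Real.exp (-x))))

/-- The first `k` terms `x 0, …, x (k - 1)` of a sequence of coupons contain every coupon. -/
def Collected {n : ℕ} (x : ℕ → Fin n) (k : ℕ) : Prop :=
  x '' Set.Iio k = Set.univ

/-- The completion time: the least `k ≥ 1` such that the first `k` coupons contain every coupon
(with value `0` for a sequence that never contains all of them). -/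
noncomputable def completionTime {n : ℕ} (x : ℕ → Fin n) : ℕ :=
  sInf {k : ℕ | 1 ≤ k ∧ Collected x k}

/-- The normalized completion time `T / n - log n` of the random sequence of coupons `X`. -/
noncomputable def normalizedTime {n : ℕ} {Ω : Type*} (X : ℕ → Ω → Fin n) (ω : Ω) : ℝ :=
  (completionTime fun i => X i ω : ℝ) / n - Real.log n

end CouponCollector

namespace CouponCollector

/-! The proof is by Poissonization. If the draws occur at the times of a Poisson process of rate
`n`, each kind arrives at rate `1` independently of the others, so the completion time `S` is the
maximum of `n` standard exponentials. It is also a sum of `T` exponentials of rate `n`, with `T`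
independent of them. At the level of laws, this says that the mixture of Gamma(`k + 1`, `n`) laws
weighted by `P(T = k + 1)` has distribution function `(1 - exp (-t)) ^ n`; inclusion-exclusion
reduces it to one exponential series per set of missing kinds
(`hasSum_completionProb_mul_gammaPDFReal`).

Two comparisons remain. A monotone function of a Gumbel variable `Z` has the law of `S`
(`map_gumbelToMax`), and it differs from `Z + log n` by at most `exp (-Z) / n`, which costs `O(1/n)`
for 1-Lipschitz `f`. Replacing each Gamma variable by its mean `(k + 1) / n` costs only its variance
`(k + 1) / n ^ 2`, because `f'` is Lipschitz and the first-order term cancels. Averaged over `T`,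
this is `E[S] / n`, and the same coupling gives `E[S] = O(log n)`. -/

/-- The probability that `k` uniform coupons contain each of `n` kinds, as given by
inclusion-exclusion over the sets of missing kinds. -/
noncomputable def collectedProb (n k : ℕ) : ℝ :=
  ∑ S : Finset (Fin n), (-1 : ℝ) ^ S.card * (1 - S.card / n) ^ k

/-- The probability that the collection of `n` coupons is completed by the draw number `k + 1`. -/
noncomputable def completionProb (n k : ℕ) : ℝ :=
  collectedProb n (k + 1) - collectedProb n k

/-! ### Completion times of a fixed sequence, and inclusion-exclusion. -/

lemma collected_iff {n : ℕ} {x : ℕ → Fin n} {k : ℕ} :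
    Collected x k ↔ ∀ c, ∃ i < k, x i = c := by
  simp [Collected, Set.eq_univ_iff_forall]

lemma Collected.mono {n : ℕ} {x : ℕ → Fin n} {k l : ℕ} (h : Collected x k) (hkl : k ≤ l) :
    Collected x l := by
  rw [collected_iff] at h ⊢
  intro c
  obtain ⟨i, hi, hc⟩ := h c
  exact ⟨i, hi.trans_le hkl, hc⟩

lemma not_collected_zero {n : ℕ} [NeZero n] (x : ℕ → Fin n) : ¬ Collected x 0 := by
  rw [collected_iff]
  intro h
  obtain ⟨i, hi, -⟩ := h 0
  exact absurd hi (Nat.not_lt_zero i)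

/-- Collections only grow, and nothing is complete at time `0` since there is at least one kind.
Using `k + 1` keeps clear of the default value `0`. -/
lemma completionTime_eq_succ_iff {n : ℕ} [NeZero n] {x : ℕ → Fin n} {k : ℕ} :
    completionTime x = k + 1 ↔ Collected x (k + 1) ∧ ¬ Collected x k := by
  unfold completionTime
  constructor
  · intro h
    have hmem := Nat.sInf_mem (Nat.nonempty_of_sInf_eq_succ h)
    rw [h] at hmem
    refine ⟨hmem.2, fun hk => ?_⟩
    have hk0 : 1 ≤ k := by
      rcases Nat.eq_zero_or_pos k with rfl | hk0
      · exact absurd hk (not_collected_zero x)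
      · exact hk0
    have := Nat.sInf_le (s := {k | 1 ≤ k ∧ Collected x k}) ⟨hk0, hk⟩
    omega
  · rintro ⟨h1, h2⟩
    refine le_antisymm (Nat.sInf_le ⟨by omega, h1⟩) ?_
    refine le_csInf ⟨k + 1, by omega, h1⟩ ?_
    rintro l ⟨-, hl⟩
    by_contra hlt
    exact h2 (hl.mono (by omega))

lemma completionTime_eq_zero {n : ℕ} [NeZero n] {x : ℕ → Fin n} (h : completionTime x = 0) (k : ℕ) :
    ¬ Collected x k := by
  intro hk
  have hk1 : Collected x (k + 1) := hk.mono (Nat.le_succ k)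
  have := Nat.sInf_mem (s := {k | 1 ≤ k ∧ Collected x k}) ⟨k + 1, by omega, hk1⟩
  change sInf _ = 0 at h
  rw [h] at this
  exact absurd this.1 (by norm_num)

/-- Inclusion-exclusion for the indicator of having seen every coupon. -/
lemma indicator_collected {n : ℕ} (x : ℕ → Fin n) (k : ℕ) :
    {x | Collected x k}.indicator (1 : (ℕ → Fin n) → ℝ) x =
      ∑ S : Finset (Fin n), (-1 : ℝ) ^ S.card *
        {x : ℕ → Fin n | ∀ i < k, x i ∉ S}.indicator (1 : (ℕ → Fin n) → ℝ) x := by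
  classical
  -- The indicator is the product over `c` of `1 - 1{c is missing}`; expanding it over subsets gives
  -- the alternating sum.
  have key : ∀ S : Finset (Fin n),
      ∏ c ∈ S, -(if ∀ i < k, x i ≠ c then (1 : ℝ) else 0) = (-1 : ℝ) ^ S.card *
        {x : ℕ → Fin n | ∀ i < k, x i ∉ S}.indicator (1 : (ℕ → Fin n) → ℝ) x := by
    intro S
    rw [Finset.prod_neg, Finset.prod_ite_zero]
    congr 1
    simp only [Set.indicator_apply, Set.mem_ofPred_eq, Finset.prod_const_one, Pi.one_apply]
    refine if_congr ?_ rfl rfl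
    constructor
    · intro h i hi hS
      exact h _ hS i hi rfl
    · intro h c hc i hi hic
      exact h i hi (hic ▸ hc)
  simp_rw [← key]
  rw [← Finset.powerset_univ, ← Finset.prod_one_add]
  simp only [Set.indicator_apply, Set.mem_ofPred_eq, Pi.one_apply, collected_iff]
  have : ∀ c, (1 + -(if ∀ i < k, x i ≠ c then (1 : ℝ) else 0)) =
      if ∃ i < k, x i = c then 1 else 0 := by
    intro c
    by_cases h : ∃ i < k, x i = c
    · rw [if_pos h, if_neg (by push Not; exact h)]; norm_num
    · rw [if_neg h, if_pos (by push Not at h; exact h)]; norm_num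
  simp_rw [this]
  rw [Finset.prod_ite_zero]
  simp

lemma measurableSet_collected (n k : ℕ) : MeasurableSet {x : ℕ → Fin n | Collected x k} := by
  simp only [collected_iff]
  measurability

lemma measurable_completionTime (n : ℕ) [NeZero n] :
    Measurable (completionTime : (ℕ → Fin n) → ℕ) := by
  have hsucc : ∀ k, MeasurableSet ((completionTime : (ℕ → Fin n) → ℕ) ⁻¹' {k + 1}) := by
    intro k
    have : (completionTime : (ℕ → Fin n) → ℕ) ⁻¹' {k + 1} =
        {x | Collected x (k + 1)} \ {x | Collected x k} := by
      ext x
      simp [completionTime_eq_succ_iff]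
    rw [this]
    exact (measurableSet_collected n (k + 1)).diff (measurableSet_collected n k)
  refine measurable_to_countable' fun k => ?_
  rcases k with _ | k
  · have : (completionTime : (ℕ → Fin n) → ℕ) ⁻¹' {0} =
        (⋃ k, (completionTime : (ℕ → Fin n) → ℕ) ⁻¹' {k + 1})ᶜ := by
      ext x
      simp only [Set.mem_preimage, Set.mem_singleton_iff, Set.mem_compl_iff, Set.mem_iUnion,
        not_exists]
      constructor
      · intro h k
        omega
      · intro h
        by_contra h0
        exact h (completionTime x - 1) (by omega)
    rw [this]
    exact (MeasurableSet.iUnion hsucc).compl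
  · exact hsucc k

/-! ### The law of the completion time. -/

section Law

variable {n : ℕ} {Ω : Type*} [MeasurableSpace Ω] {P : Measure Ω} {X : ℕ → Ω → Fin n}

lemma measureReal_forall_notMem [NeZero n] (hX : ∀ i, Measurable (X i)) (hind : iIndepFun X P)
    (hunif : ∀ i, P.map (X i) = uniformOn Set.univ) (S : Finset (Fin n)) (k : ℕ) :
    P.real {ω | ∀ i < k, X i ω ∉ S} = (1 - S.card / n) ^ k := by
  have h1 : {ω | ∀ i < k, X i ω ∉ S} =
      ⋂ i ∈ Finset.range k, X i ⁻¹' ((S : Set (Fin n))ᶜ) := by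
    ext ω
    simp
  have hn : (n : ℝ) ≠ 0 := Nat.cast_ne_zero.2 (NeZero.ne n)
  have h2 : ∀ i, P.real (X i ⁻¹' ((S : Set (Fin n))ᶜ)) = 1 - S.card / n := by
    intro i
    rw [← map_measureReal_apply (hX i) (MeasurableSet.of_discrete), hunif i,
      measureReal_def, uniformOn_univ, ← Finset.coe_compl, Measure.count_apply_finset,
      Finset.card_compl, Fintype.card_fin, ENNReal.toReal_div, ENNReal.toReal_natCast,
      ENNReal.toReal_natCast, Nat.cast_sub (by simpa using Finset.card_le_univ S)]
    field_simp
  rw [h1, measureReal_def,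
    hind.measure_inter_preimage_eq_mul (Finset.range k) (fun _ _ => MeasurableSet.of_discrete),
    ENNReal.toReal_prod]
  simp_rw [← measureReal_def, h2]
  simp

variable [IsProbabilityMeasure P]

lemma measureReal_collected [NeZero n] (hX : ∀ i, Measurable (X i)) (hind : iIndepFun X P)
    (hunif : ∀ i, P.map (X i) = uniformOn Set.univ) (k : ℕ) :
    P.real {ω | Collected (fun i => X i ω) k} = collectedProb n k := by
  have hXm : Measurable fun ω => fun i => X i ω := measurable_pi_lambda _ hX
  have hm : MeasurableSet {ω | Collected (fun i => X i ω) k} :=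
    hXm (measurableSet_collected n k)
  have hmS : ∀ S : Finset (Fin n), MeasurableSet {ω | ∀ i < k, X i ω ∉ S} := by
    intro S
    have : {ω | ∀ i < k, X i ω ∉ S} = ⋂ i, ⋂ (_ : i < k), X i ⁻¹' ((S : Set (Fin n))ᶜ) := by
      ext ω
      simp
    rw [this]
    exact MeasurableSet.iInter fun i => MeasurableSet.iInter fun _ =>
      hX i MeasurableSet.of_discrete
  rw [← integral_indicator_one hm]
  have h : ∀ ω, {ω | Collected (fun i => X i ω) k}.indicator (1 : Ω → ℝ) ω =
      ∑ S : Finset (Fin n), (-1 : ℝ) ^ S.card *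
        {ω | ∀ i < k, X i ω ∉ S}.indicator (1 : Ω → ℝ) ω := by
    intro ω
    exact indicator_collected (fun i => X i ω) k
  simp_rw [h]
  rw [integral_finsetSum]
  · refine Finset.sum_congr rfl fun S _ => ?_
    rw [integral_const_mul, integral_indicator_one (hmS S),
      measureReal_forall_notMem hX hind hunif]
  · intro S _
    exact ((integrable_const (1 : ℝ)).indicator (hmS S)).const_mul _

lemma measureReal_completionTime_eq_succ [NeZero n] (hX : ∀ i, Measurable (X i))
    (hind : iIndepFun X P) (hunif : ∀ i, P.map (X i) = uniformOn Set.univ) (k : ℕ) :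
    P.real {ω | completionTime (fun i => X i ω) = k + 1} = completionProb n k := by
  have hXm : Measurable fun ω => fun i => X i ω := measurable_pi_lambda _ hX
  have : {ω | completionTime (fun i => X i ω) = k + 1} =
      {ω | Collected (fun i => X i ω) (k + 1)} \ {ω | Collected (fun i => X i ω) k} := by
    ext ω
    simp [completionTime_eq_succ_iff]
  rw [this, measureReal_sdiff (by intro ω h; exact Collected.mono h (Nat.le_succ k))
    (show MeasurableSet {ω | Collected (fun i => X i ω) k} from
      hXm (measurableSet_collected n k)), measureReal_collected hX hind hunif,
    measureReal_collected hX hind hunif, completionProb]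

/-- Only the empty set survives: every other base lies in `[0, 1)`. -/
lemma tendsto_collectedProb (n : ℕ) [NeZero n] :
    Filter.Tendsto (collectedProb n) Filter.atTop (nhds 1) := by
  have h : ∀ S : Finset (Fin n), Filter.Tendsto
      (fun k : ℕ => (-1 : ℝ) ^ S.card * (1 - S.card / n) ^ k) Filter.atTop
      (nhds (if S = ∅ then 1 else 0)) := by
    intro S
    split_ifs with hS
    · simp [hS]
    · have hn : (0 : ℝ) < n := Nat.cast_pos.2 (NeZero.pos n)
      have h0 : (0 : ℝ) < S.card := Nat.cast_pos.2 (Finset.card_pos.2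
        (Finset.nonempty_iff_ne_empty.2 hS))
      have h1 : (S.card : ℝ) ≤ n := by
        exact_mod_cast (by simpa using Finset.card_le_univ S)
      have h2 : (S.card : ℝ) / n ≤ 1 := (div_le_one hn).2 h1
      have h3 : 0 < (S.card : ℝ) / n := div_pos h0 hn
      simpa using (tendsto_pow_atTop_nhds_zero_of_lt_one (sub_nonneg.2 h2)
        (by linarith)).const_mul ((-1 : ℝ) ^ S.card)
  simpa using! tendsto_finsetSum Finset.univ fun S _ => h S

lemma ae_exists_collected [NeZero n] (hX : ∀ i, Measurable (X i))
    (hind : iIndepFun X P) (hunif : ∀ i, P.map (X i) = uniformOn Set.univ) :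
    ∀ᵐ ω ∂P, ∃ k, 1 ≤ k ∧ Collected (fun i => X i ω) k := by
  have hle : ∀ k, P.real {ω | ∃ k, 1 ≤ k ∧ Collected (fun i => X i ω) k} ≥ collectedProb n k := by
    intro k
    rw [← measureReal_collected hX hind hunif k]
    exact measureReal_mono fun ω h => ⟨k + 1, by omega, Collected.mono h (Nat.le_succ k)⟩
  have h1 := le_of_tendsto' (tendsto_collectedProb n) hle
  have hm : MeasurableSet {ω | ∃ k, 1 ≤ k ∧ Collected (fun i => X i ω) k} := by
    have : {ω | ∃ k, 1 ≤ k ∧ Collected (fun i => X i ω) k} =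
        ⋃ k, ⋃ (_ : 1 ≤ k), (fun ω => fun i => X i ω) ⁻¹' {x | Collected x k} := by
      ext ω
      simp
    rw [this]
    exact MeasurableSet.iUnion fun k => MeasurableSet.iUnion fun _ =>
      measurable_pi_lambda _ hX (measurableSet_collected n k)
  rw [ae_iff_measure_eq hm.nullMeasurableSet, measure_univ]
  refine le_antisymm prob_le_one ?_
  rw [← ofReal_measureReal]
  simpa using ENNReal.ofReal_le_ofReal h1

lemma map_normalizedTime [NeZero n] (hX : ∀ i, Measurable (X i))
    (hind : iIndepFun X P) (hunif : ∀ i, P.map (X i) = uniformOn Set.univ) :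
    P.map (normalizedTime X) = Measure.sum fun k =>
      ENNReal.ofReal (completionProb n k) • Measure.dirac (((k : ℝ) + 1) / n - Real.log n) := by
  have hTm : Measurable fun ω => completionTime fun i => X i ω :=
    (measurable_completionTime n).comp (measurable_pi_lambda _ hX)
  have hT : P.map (fun ω => completionTime fun i => X i ω) =
      Measure.sum fun k => ENNReal.ofReal (completionProb n k) • Measure.dirac (k + 1) := by
    refine Measure.ext_of_singleton fun m => ?_
    rw [Measure.map_apply hTm (measurableSet_singleton m), Measure.sum_apply _
      (measurableSet_singleton m)]
    rcases m with _ | m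
    -- The value `0` is taken only by sequences that are never complete, a null event.
    · have : P ((fun ω => completionTime fun i => X i ω) ⁻¹' {0}) = 0 := by
        refine measure_mono_null ?_ (ae_iff.1 (ae_exists_collected hX hind hunif))
        rintro ω hω ⟨k, -, hk⟩
        exact completionTime_eq_zero hω k hk
      rw [this]
      simp
    · rw [tsum_eq_single m]
      · rw [← measureReal_completionTime_eq_succ hX hind hunif]
        simp [Set.preimage]
      · intro k hk
        simp [hk]
  have hcomp : normalizedTime X = (fun m : ℕ => (m : ℝ) / n - Real.log n) ∘
      fun ω => completionTime fun i => X i ω := rfl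
  rw [hcomp, ← Measure.map_map (by fun_prop) hTm, hT, Measure.map_sum (by fun_prop)]
  congr 1
  ext1 k
  rw [Measure.map_smul, Measure.map_dirac' (by fun_prop)]
  push_cast
  rfl

/-- The sign is not visible in the alternating sum; it comes from the probabilistic meaning. The
analytic lemmas below take it as the hypothesis `hq`. -/
lemma completionProb_nonneg [NeZero n] (hX : ∀ i, Measurable (X i))
    (hind : iIndepFun X P) (hunif : ∀ i, P.map (X i) = uniformOn Set.univ) (k : ℕ) :
    0 ≤ completionProb n k := by
  rw [← measureReal_completionTime_eq_succ hX hind hunif]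
  exact measureReal_nonneg

end Law

/-! ### Integrability and distribution function of the Gumbel law. -/

/-- The density of the standard Gumbel distribution. -/
noncomputable def gumbelDensity (x : ℝ) : ℝ := Real.exp (-(x + Real.exp (-x)))

lemma gumbelDensity_nonneg (x : ℝ) : 0 ≤ gumbelDensity x := (Real.exp_pos _).le

lemma continuous_gumbelDensity : Continuous gumbelDensity := by
  unfold gumbelDensity
  fun_prop

lemma gumbelDensity_eq (x : ℝ) :
    gumbelDensity x = Real.exp (-x) * Real.exp (-Real.exp (-x)) := by
  rw [gumbelDensity, ← Real.exp_add]
  ring_nf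

lemma gumbelDensity_le_exp_neg (x : ℝ) : gumbelDensity x ≤ Real.exp (-x) := by
  rw [gumbelDensity_eq]
  exact mul_le_of_le_one_right (Real.exp_pos _).le (Real.exp_le_one_iff.2
    (neg_nonpos.2 (Real.exp_pos _).le))

/-- With `u = exp (-x)` this is `u ^ 2 * exp (-u) ≤ 6 / u`, that is, `u ^ 3 / 3! ≤ exp u`. -/
lemma exp_neg_mul_gumbelDensity_le (x : ℝ) : Real.exp (-x) * gumbelDensity x ≤ 6 * Real.exp x := by
  have h := Real.pow_div_factorial_le_exp (x := Real.exp (-x)) (Real.exp_pos _).le 3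
  have h3 : (Nat.factorial 3 : ℝ) = 6 := by norm_num [Nat.factorial]
  rw [h3] at h
  rw [gumbelDensity_eq, Real.exp_neg (Real.exp (-x))]
  have h0 := Real.exp_pos (-x)
  have hE := Real.exp_pos (Real.exp (-x))
  have hx : Real.exp x = (Real.exp (-x))⁻¹ := by rw [Real.exp_neg, inv_inv]
  rw [hx]
  field_simp
  have : Real.exp (-x) * Real.exp x = 1 := by rw [← Real.exp_add]; simp
  nlinarith

lemma integrableOn_Iic_exp_neg_mul_gumbelDensity :
    IntegrableOn (fun x => Real.exp (-x) * gumbelDensity x) (Set.Iic 0) := by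
  have hc := continuous_gumbelDensity
  refine ((integrableOn_exp_Iic 0).const_mul 6).mono'
    (by fun_prop : Continuous fun x => Real.exp (-x) * gumbelDensity x).aestronglyMeasurable
    (ae_of_all _ fun x => ?_)
  rw [Real.norm_of_nonneg (mul_nonneg (Real.exp_pos _).le (gumbelDensity_nonneg x))]
  exact exp_neg_mul_gumbelDensity_le x

/-- Functions of at most the growth of `exp (-x)` at `-∞` and of `exp (x / 2)` at `∞` are
integrable with respect to the Gumbel distribution. -/
lemma integrable_mul_gumbelDensity {g : ℝ → ℝ} (hg : Continuous g) {A : ℝ}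
    (hneg : ∀ x ≤ 0, |g x| ≤ A * Real.exp (-x)) (hpos : ∀ x, 0 < x → |g x| ≤ A * Real.exp (x / 2)) :
    Integrable (fun x => g x * gumbelDensity x) := by
  have hc := continuous_gumbelDensity
  have hm : Continuous fun x => g x * gumbelDensity x := by fun_prop
  rw [← integrableOn_univ, ← Set.Iic_union_Ioi (a := (0 : ℝ)), integrableOn_union]
  constructor
  · refine (integrableOn_Iic_exp_neg_mul_gumbelDensity.const_mul A).mono'
      hm.aestronglyMeasurable ((ae_restrict_iff' measurableSet_Iic).2 (ae_of_all _ fun x hx => ?_))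
    rw [norm_mul, Real.norm_eq_abs, Real.norm_of_nonneg (gumbelDensity_nonneg x), ← mul_assoc]
    exact mul_le_mul_of_nonneg_right (hneg x hx) (gumbelDensity_nonneg x)
  · refine ((integrableOn_exp_mul_Ioi (a := -(1 / 2)) (by norm_num) 0).const_mul A).mono'
      hm.aestronglyMeasurable ((ae_restrict_iff' measurableSet_Ioi).2 (ae_of_all _ fun x hx => ?_))
    rw [norm_mul, Real.norm_eq_abs, Real.norm_of_nonneg (gumbelDensity_nonneg x)]
    calc |g x| * gumbelDensity x ≤ (A * Real.exp (x / 2)) * Real.exp (-x) :=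
          mul_le_mul (hpos x hx) (gumbelDensity_le_exp_neg x) (gumbelDensity_nonneg x)
            ((abs_nonneg _).trans (hpos x hx))
      _ = A * Real.exp (-(1 / 2) * x) := by
          rw [mul_assoc, ← Real.exp_add]
          ring_nf

lemma integrable_gumbel_iff {g : ℝ → ℝ} :
    Integrable g gumbel ↔ Integrable (fun x => g x * gumbelDensity x) := by
  have hm : Measurable fun x => ENNReal.ofReal (gumbelDensity x) :=
    continuous_gumbelDensity.measurable.ennreal_ofReal
  change Integrable g (volume.withDensity fun x => ENNReal.ofReal (gumbelDensity x)) ↔ _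
  rw [integrable_withDensity_iff hm (ae_of_all _ fun _ => ENNReal.ofReal_lt_top)]
  simp_rw [ENNReal.toReal_ofReal (gumbelDensity_nonneg _)]

lemma integrable_gumbelDensity : Integrable gumbelDensity := by
  have := integrable_mul_gumbelDensity (g := fun _ => 1) continuous_const (A := 1)
    (fun x hx => by simpa using hx) (fun x hx => by simpa using (half_pos hx).le)
  simpa using this

instance : IsFiniteMeasure gumbel :=
  isFiniteMeasure_withDensity_ofReal integrable_gumbelDensity.2

lemma integrable_exp_neg_gumbel : Integrable (fun x => Real.exp (-x)) gumbel := by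
  rw [integrable_gumbel_iff]
  refine integrable_mul_gumbelDensity (by fun_prop) (A := 1) (fun x _ => ?_) (fun x hx => ?_)
  · simp [abs_of_pos (Real.exp_pos _)]
  · rw [abs_of_pos (Real.exp_pos _), one_mul]
    exact Real.exp_le_exp.2 (by linarith)

lemma integrable_id_gumbel : Integrable (fun x : ℝ => x) gumbel := by
  rw [integrable_gumbel_iff]
  refine integrable_mul_gumbelDensity (by fun_prop) (A := 2) (fun x hx => ?_) (fun x hx => ?_)
  · rw [abs_of_nonpos hx]
    linarith [Real.add_one_le_exp (-x), Real.exp_pos (-x)]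
  · rw [abs_of_pos hx]
    linarith [Real.add_one_le_exp (x / 2)]

lemma gumbel_Iic (t : ℝ) : gumbel (Set.Iic t) = ENNReal.ofReal (Real.exp (-Real.exp (-t))) := by
  change (volume.withDensity fun x => ENNReal.ofReal (gumbelDensity x)) _ = _
  rw [withDensity_apply _ measurableSet_Iic, ← ofReal_integral_eq_lintegral_ofReal
    integrable_gumbelDensity.integrableOn (ae_of_all _ gumbelDensity_nonneg)]
  congr 1
  have hderiv : ∀ x ∈ Set.Iic t,
      HasDerivAt (fun x => Real.exp (-Real.exp (-x))) (gumbelDensity x) x := by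
    intro x _
    refine ((hasDerivAt_neg x).exp.fun_neg.exp).congr_deriv ?_
    rw [gumbelDensity_eq]
    ring
  have hlim : Filter.Tendsto (fun x => Real.exp (-Real.exp (-x))) Filter.atBot (nhds 0) :=
    Real.tendsto_exp_neg_atTop_nhds_zero.comp
      (Real.tendsto_exp_atTop.comp Filter.tendsto_neg_atBot_atTop)
  rw [integral_Iic_of_hasDerivAt_of_tendsto' hderiv integrable_gumbelDensity.integrableOn hlim,
    sub_zero]

/-! ### Coupling the Gumbel law with the maximum of exponentials. -/

/-- If `Z` has the standard Gumbel distribution, then `gumbelToMax n Z` is distributed as the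
maximum of `n` independent standard exponential random variables. -/
noncomputable def gumbelToMax (n : ℕ) (z : ℝ) : ℝ := -Real.log (1 - Real.exp (-(Real.exp (-z) / n)))

lemma measurable_gumbelToMax (n : ℕ) : Measurable (gumbelToMax n) := by
  unfold gumbelToMax
  fun_prop

lemma one_sub_exp_pos {y : ℝ} (hy : 0 < y) : 0 < 1 - Real.exp (-y) := by
  have := Real.exp_lt_exp.2 (neg_lt_zero.2 hy)
  rw [Real.exp_zero] at this
  linarith

lemma map_gumbelToMax_Iic {n : ℕ} (hn : n ≠ 0) (t : ℝ) :
    gumbel.map (gumbelToMax n) (Set.Iic t) =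
      ENNReal.ofReal (if 0 ≤ t then (1 - Real.exp (-t)) ^ n else 0) := by
  have hn0 : (0 : ℝ) < n := Nat.cast_pos.2 (Nat.pos_of_ne_zero hn)
  rw [Measure.map_apply (measurable_gumbelToMax n) measurableSet_Iic]
  have hy : ∀ z : ℝ, 0 < Real.exp (-z) / n := fun z => div_pos (Real.exp_pos _) hn0
  have hiff : ∀ z, gumbelToMax n z ≤ t ↔ Real.exp (-(Real.exp (-z) / n)) ≤ 1 - Real.exp (-t) := by
    intro z
    rw [gumbelToMax, neg_le, Real.le_log_iff_exp_le (one_sub_exp_pos (hy z))]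
    constructor <;> intro h <;> linarith
  rcases le_or_gt t 0 with ht | ht
  · have h1 : gumbelToMax n ⁻¹' Set.Iic t = ∅ := by
      ext z
      simp only [Set.mem_preimage, Set.mem_Iic, hiff, Set.mem_empty_iff_false, iff_false, not_le]
      have : 1 ≤ Real.exp (-t) := Real.one_le_exp (by linarith)
      linarith [Real.exp_pos (-(Real.exp (-z) / n))]
    rw [h1, measure_empty]
    split_ifs with h
    · have : t = 0 := le_antisymm ht h
      simp [this, hn]
    · simp
  · have hu := one_sub_exp_pos ht
    have hlog : Real.log (1 - Real.exp (-t)) < 0 :=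
      Real.log_neg hu (by linarith [Real.exp_pos (-t)])
    have ha : 0 < -(n * Real.log (1 - Real.exp (-t))) := by nlinarith
    have h1 : gumbelToMax n ⁻¹' Set.Iic t =
        Set.Iic (-Real.log (-(n * Real.log (1 - Real.exp (-t))))) := by
      ext z
      rw [Set.mem_preimage, Set.mem_Iic, hiff, ← Real.le_log_iff_exp_le hu, Set.mem_Iic,
        le_neg, Real.log_le_iff_le_exp ha, neg_le, le_div_iff₀ hn0]
      constructor <;> intro h <;> linarith
    rw [h1, gumbel_Iic, if_pos ht.le, neg_neg, Real.exp_log ha, neg_neg, Real.exp_nat_mul,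
      Real.exp_log hu]

/-- With `y = exp (-z) / n` the difference is `log (y / (1 - exp (-y)))`, and `y * exp (-y) ≤ 1 -
exp (-y) ≤ y` puts it in `[0, y]`. -/
lemma abs_gumbelToMax_sub_le {n : ℕ} (hn : n ≠ 0) (z : ℝ) :
    |gumbelToMax n z - Real.log n - z| ≤ Real.exp (-z) / n := by
  have hn0 : (0 : ℝ) < n := Nat.cast_pos.2 (Nat.pos_of_ne_zero hn)
  set y := Real.exp (-z) / n with hy
  have hy0 : 0 < y := div_pos (Real.exp_pos _) hn0
  have hu := one_sub_exp_pos hy0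
  have hlogy : Real.log y = -z - Real.log n := by
    rw [hy, Real.log_div (Real.exp_pos _).ne' hn0.ne', Real.log_exp]
  have h1 : gumbelToMax n z - Real.log n - z = Real.log y - Real.log (1 - Real.exp (-y)) := by
    rw [hlogy, gumbelToMax]
    ring
  have h2 : Real.log (1 - Real.exp (-y)) ≤ Real.log y :=
    Real.log_le_log hu (by linarith [Real.add_one_le_exp (-y)])
  have h3 : Real.log y - y ≤ Real.log (1 - Real.exp (-y)) := by
    have : y * Real.exp (-y) ≤ 1 - Real.exp (-y) := by
      have h4 := Real.add_one_le_exp y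
      have h5 : Real.exp y * Real.exp (-y) = 1 := by rw [← Real.exp_add]; simp
      nlinarith [Real.exp_pos (-y)]
    have h6 := Real.log_le_log (by positivity) this
    rw [Real.log_mul hy0.ne' (Real.exp_pos _).ne', Real.log_exp] at h6
    linarith
  rw [h1, abs_le]
  constructor <;> linarith

/-! ### The Poissonized completion time is the maximum of exponentials. -/

/-- The law of a sum of `T` independent exponential random variables of rate `n`, where `T` is an
independent random variable with the law of the completion time of `n` coupons. -/
noncomputable def poissonizedLaw (n : ℕ) : Measure ℝ :=
  Measure.sum fun k : ℕ =>
    ENNReal.ofReal (completionProb n k) • gammaMeasure ((k : ℝ) + 1) n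

/-- The density of the maximum of `n` independent standard exponential random variables. -/
noncomputable def maxDensity (n : ℕ) (x : ℝ) : ℝ :=
  ∑ S : Finset (Fin n), (-1 : ℝ) ^ S.card * (-S.card * Real.exp (-(S.card * x)))

lemma continuous_maxDensity (n : ℕ) : Continuous (maxDensity n) := by
  unfold maxDensity
  fun_prop

lemma hasDerivAt_one_sub_exp_pow (n : ℕ) (x : ℝ) :
    HasDerivAt (fun x => (1 - Real.exp (-x)) ^ n) (maxDensity n x) x := by
  have h : (fun x => (1 - Real.exp (-x)) ^ n) =
      fun x => ∑ S : Finset (Fin n), (-1 : ℝ) ^ S.card * Real.exp (-(S.card * x)) := by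
    funext x
    have := Fintype.sum_pow_mul_eq_add_pow (Fin n) (-Real.exp (-x)) 1
    rw [Fintype.card_fin] at this
    rw [sub_eq_neg_add, ← this]
    refine Finset.sum_congr rfl fun S _ => ?_
    rw [one_pow, mul_one, neg_pow, ← Real.exp_nat_mul, mul_neg]
  rw [h]
  refine HasDerivAt.fun_sum fun S _ => HasDerivAt.const_mul _ ?_
  refine (((hasDerivAt_id x).const_mul (S.card : ℝ)).fun_neg.exp).congr_deriv ?_
  simp
  ring

lemma completionProb_eq {n : ℕ} (hn : n ≠ 0) (k : ℕ) :
    completionProb n k =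
      ∑ S : Finset (Fin n), (-1 : ℝ) ^ S.card * (-S.card / n * (1 - S.card / n) ^ k) := by
  have hn0 : (n : ℝ) ≠ 0 := Nat.cast_ne_zero.2 hn
  rw [completionProb, collectedProb, collectedProb, ← Finset.sum_sub_distrib]
  refine Finset.sum_congr rfl fun S _ => ?_
  ring

lemma gammaPDFReal_succ (n k : ℕ) {x : ℝ} (hx : 0 ≤ x) :
    gammaPDFReal ((k : ℝ) + 1) n x =
      n * Real.exp (-(n * x)) * ((n * x) ^ k / (Nat.factorial k : ℝ)) := by
  rw [gammaPDFReal, if_pos hx, Real.Gamma_nat_eq_factorial, add_sub_cancel_right, Real.rpow_natCast,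
    mul_pow]
  have : (n : ℝ) ^ ((k : ℝ) + 1) = (n : ℝ) ^ k * n := by
    rw [← pow_succ]
    exact_mod_cast Real.rpow_natCast (n : ℝ) (k + 1)
  rw [this]
  ring

/-- For fixed `S` the sum over `k` is an exponential series, and `exp (-n x) * exp ((1 - |S| / n) n
x) = exp (-|S| x)`. -/
lemma hasSum_completionProb_mul_gammaPDFReal {n : ℕ} (hn : n ≠ 0) {x : ℝ} (hx : 0 ≤ x) :
    HasSum (fun k : ℕ => completionProb n k * gammaPDFReal ((k : ℝ) + 1) n x)
      (maxDensity n x) := by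
  have hn0 : (n : ℝ) ≠ 0 := Nat.cast_ne_zero.2 hn
  simp_rw [completionProb_eq hn, gammaPDFReal_succ n _ hx, Finset.sum_mul]
  refine hasSum_sum fun S _ => ?_
  have h := (NormedSpace.expSeries_div_hasSum_exp ((1 - S.card / n : ℝ) * (n * x))).mul_left
    ((-1 : ℝ) ^ S.card * (-S.card) * Real.exp (-(n * x)))
  rw [← Real.exp_eq_exp_ℝ, mul_assoc _ (Real.exp _) (Real.exp _), ← Real.exp_add, mul_assoc] at h
  have he : -(n * x) + (1 - S.card / n : ℝ) * (n * x) = -(S.card * x) := by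
    field_simp
    ring
  rw [he] at h
  have hfun : ∀ k : ℕ, (-1 : ℝ) ^ S.card * (-S.card / n * (1 - S.card / n) ^ k) *
      (n * Real.exp (-(n * x)) * ((n * x) ^ k / (Nat.factorial k : ℝ))) =
      (-1) ^ S.card * (-S.card * Real.exp (-(n * x))) *
        (((1 - S.card / n) * (n * x)) ^ k / (Nat.factorial k : ℝ)) := by
    intro k
    rw [mul_pow (1 - S.card / n : ℝ)]
    generalize (1 - S.card / n : ℝ) ^ k = u, ((n : ℝ) * x) ^ k = v
    field_simp
  simp_rw [hfun]
  rw [← mul_assoc (_ ^ _) (-(S.card : ℝ)) (Real.exp (-(S.card * x)))]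
  exact h

lemma poissonizedLaw_Iic {n : ℕ} (hn : n ≠ 0) (hq : ∀ k, 0 ≤ completionProb n k) (t : ℝ) :
    poissonizedLaw n (Set.Iic t) =
      ENNReal.ofReal (if 0 ≤ t then (1 - Real.exp (-t)) ^ n else 0) := by
  have hn0 : (0 : ℝ) < n := Nat.cast_pos.2 (Nat.pos_of_ne_zero hn)
  have hnn : ∀ (k : ℕ) x, 0 ≤ completionProb n k * gammaPDFReal ((k : ℝ) + 1) n x := fun k x =>
    mul_nonneg (hq k) (gammaPDFReal_nonneg (by positivity) hn0 x)
  -- Nonnegativity is inherited from the mixture of Gamma densities.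
  have hmax : ∀ x, 0 ≤ x → 0 ≤ maxDensity n x := fun x hx =>
    (hasSum_completionProb_mul_gammaPDFReal hn hx).nonneg fun k => hnn k x
  have h1 : poissonizedLaw n (Set.Iic t) =
      ∫⁻ x in Set.Iic t, (Set.Ici 0).indicator (fun x => ENNReal.ofReal (maxDensity n x)) x := by
    rw [poissonizedLaw, Measure.sum_apply _ measurableSet_Iic]
    simp only [Measure.smul_apply, gammaMeasure, smul_eq_mul,
      withDensity_apply _ measurableSet_Iic]
    have : ∀ k : ℕ, ENNReal.ofReal (completionProb n k) *
        ∫⁻ x in Set.Iic t, gammaPDF ((k : ℝ) + 1) n x =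
        ∫⁻ x in Set.Iic t, ENNReal.ofReal (completionProb n k * gammaPDFReal ((k : ℝ) + 1) n x) := by
      intro k
      rw [← lintegral_const_mul' _ _ ENNReal.ofReal_ne_top]
      simp_rw [gammaPDF, ENNReal.ofReal_mul (hq k)]
    simp_rw [this]
    rw [← lintegral_tsum fun k =>
      ((measurable_gammaPDFReal _ _).const_mul _).ennreal_ofReal.aemeasurable]
    refine lintegral_congr fun x => ?_
    by_cases hx : 0 ≤ x
    · rw [Set.indicator_of_mem (show x ∈ Set.Ici 0 from hx),
        ← (hasSum_completionProb_mul_gammaPDFReal hn hx).tsum_eq,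
        ENNReal.ofReal_tsum_of_nonneg (fun k => hnn k x)
          (hasSum_completionProb_mul_gammaPDFReal hn hx).summable]
    · rw [Set.indicator_of_notMem (show x ∉ Set.Ici 0 from hx)]
      simp [gammaPDFReal, hx]
  rw [h1, lintegral_indicator measurableSet_Ici, Measure.restrict_restrict measurableSet_Ici,
    Set.Ici_inter_Iic]
  split_ifs with ht
  · rw [← ofReal_integral_eq_lintegral_ofReal
      ((continuous_maxDensity n).continuousOn.integrableOn_compact isCompact_Icc)
      ((ae_restrict_iff' measurableSet_Icc).2 (ae_of_all _ fun x hx => hmax x hx.1)),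
      integral_Icc_eq_integral_Ioc, ← intervalIntegral.integral_of_le ht,
      intervalIntegral.integral_eq_sub_of_hasDerivAt
        (fun x _ => hasDerivAt_one_sub_exp_pow n x)
        ((continuous_maxDensity n).intervalIntegrable _ _)]
    simp [hn]
  · rw [Set.Icc_eq_empty ht]
    simp

lemma map_gumbelToMax {n : ℕ} (hn : n ≠ 0) (hq : ∀ k, 0 ≤ completionProb n k) :
    gumbel.map (gumbelToMax n) = poissonizedLaw n := by
  refine Measure.ext_of_Iic _ _ fun t => ?_
  rw [map_gumbelToMax_Iic hn, poissonizedLaw_Iic hn hq]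

/-! ### Gamma moments and smooth test functions. -/

lemma abs_sub_le_of_lipSeminorm_le {f : ℝ → ℝ} {K : ℝ} (hK : 0 ≤ K)
    (h : lipSeminorm f ≤ ENNReal.ofReal K) (x y : ℝ) : |f x - f y| ≤ K * |x - y| := by
  rcases eq_or_ne x y with rfl | hxy
  · simp
  · have h1 : ENNReal.ofReal (|f x - f y| / |x - y|) ≤ lipSeminorm f :=
      le_iSup_of_le y (le_iSup_of_le x (le_iSup_of_le hxy le_rfl))
    have h2 := (ENNReal.ofReal_le_ofReal_iff hK).1 (h1.trans h)
    exact (div_le_iff₀ (abs_pos.2 (sub_ne_zero.2 hxy))).1 h2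

lemma integral_pow_gammaMeasure {a r : ℝ} (ha : 0 < a) (hr : 0 < r) (j : ℕ) :
    ∫ x, x ^ j ∂gammaMeasure a r = Real.Gamma (a + j) / (Real.Gamma a * r ^ j) := by
  rw [gammaMeasure, integral_withDensity_eq_integral_toReal_smul
    (show Measurable (gammaPDF a r) from (measurable_gammaPDFReal a r).ennreal_ofReal)
    (ae_of_all _ fun _ => ENNReal.ofReal_lt_top)]
  have h : ∀ x, (gammaPDF a r x).toReal • x ^ j = (Set.Ici (0 : ℝ)).indicator
      (fun x => r ^ a / Real.Gamma a * (x ^ (a - 1) * x ^ j * Real.exp (-(r * x)))) x := by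
    intro x
    rw [gammaPDF, ENNReal.toReal_ofReal (gammaPDFReal_nonneg ha hr x), gammaPDFReal]
    by_cases hx : 0 ≤ x
    · rw [if_pos hx, Set.indicator_of_mem (show x ∈ Set.Ici 0 from hx), smul_eq_mul]
      ring
    · rw [if_neg hx, Set.indicator_of_notMem (show x ∉ Set.Ici 0 from hx), zero_smul]
  simp_rw [h]
  have haj : 0 < a + j := by positivity
  rw [integral_indicator measurableSet_Ici, integral_Ici_eq_integral_Ioi, integral_const_mul]
  have h2 : ∫ x in Set.Ioi (0 : ℝ), x ^ (a - 1) * x ^ j * Real.exp (-(r * x)) =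
      ∫ x in Set.Ioi (0 : ℝ), x ^ (a + j - 1) * Real.exp (-(r * x)) := by
    refine setIntegral_congr_fun measurableSet_Ioi fun x hx => ?_
    rw [← Real.rpow_add_natCast (ne_of_gt hx), add_sub_right_comm]
  rw [h2, Real.integral_rpow_mul_exp_neg_mul_Ioi haj hr, Real.rpow_add_natCast (by positivity),
    one_div, inv_pow, Real.inv_rpow hr.le]
  have := (Real.Gamma_pos_of_pos ha).ne'
  have := (Real.rpow_pos_of_pos hr a).ne'
  field_simp

/-- A nonintegrable function has Bochner integral `0`, whereas the moment formula gives a positive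
value. -/
lemma integrable_pow_gammaMeasure {a r : ℝ} (ha : 0 < a) (hr : 0 < r) (j : ℕ) :
    Integrable (fun x => x ^ j) (gammaMeasure a r) := by
  refine Integrable.of_integral_ne_zero ?_
  rw [integral_pow_gammaMeasure ha hr]
  have haj : 0 < a + j := by positivity
  have := Real.Gamma_pos_of_pos ha
  have := Real.Gamma_pos_of_pos haj
  positivity

lemma integral_id_gammaMeasure {a r : ℝ} (ha : 0 < a) (hr : 0 < r) :
    ∫ x, x ∂gammaMeasure a r = a / r := by
  have h := integral_pow_gammaMeasure ha hr 1
  simp only [pow_one, Nat.cast_one] at h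
  rw [h, Real.Gamma_add_one ha.ne']
  have := (Real.Gamma_pos_of_pos ha).ne'
  field_simp

lemma integral_sq_gammaMeasure {a r : ℝ} (ha : 0 < a) (hr : 0 < r) :
    ∫ x, x ^ 2 ∂gammaMeasure a r = a * (a + 1) / r ^ 2 := by
  have h2 : a + ((2 : ℕ) : ℝ) = a + 1 + 1 := by
    push_cast
    ring
  rw [integral_pow_gammaMeasure ha hr 2, h2, Real.Gamma_add_one (by positivity),
    Real.Gamma_add_one ha.ne']
  have := (Real.Gamma_pos_of_pos ha).ne'
  field_simp

lemma integrable_id_gammaMeasure {a r : ℝ} (ha : 0 < a) (hr : 0 < r) :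
    Integrable (fun x => x) (gammaMeasure a r) := by
  simpa using integrable_pow_gammaMeasure ha hr 1

lemma integral_sub_mean_sq_gammaMeasure {a r : ℝ} (ha : 0 < a) (hr : 0 < r) :
    ∫ x, (x - a / r) ^ 2 ∂gammaMeasure a r = a / r ^ 2 := by
  have := isProbabilityMeasure_gammaMeasure ha hr
  have h1 := integrable_id_gammaMeasure ha hr
  have h2 := integrable_pow_gammaMeasure ha hr 2
  have h : ∀ x : ℝ, (x - a / r) ^ 2 = x ^ 2 - 2 * (a / r) * x + (a / r) ^ 2 := fun x => by ring
  have h3 : Integrable (fun x => x ^ 2 - 2 * (a / r) * x) (gammaMeasure a r) :=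
    h2.sub (h1.const_mul _)
  simp_rw [h]
  rw [integral_add h3 (integrable_const _),
    integral_sub h2 (h1.const_mul _), integral_const_mul, integral_id_gammaMeasure ha hr,
    integral_sq_gammaMeasure ha hr, integral_const, probReal_univ, one_smul]
  field_simp
  ring

/-- First-order Taylor bound for a function with `1`-Lipschitz derivative. -/
lemma abs_sub_sub_deriv_mul_le {f : ℝ → ℝ} (hf : Differentiable ℝ f)
    (hf' : ∀ x y, |deriv f x - deriv f y| ≤ |x - y|) (m x : ℝ) :
    |f x - f m - deriv f m * (x - m)| ≤ (x - m) ^ 2 := by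
  -- Mean value inequality after subtracting the tangent slope at `m`: on the segment the derivative
  -- is at most `|x - m|`. The factor `1/2` of the sharp bound is not needed.
  have h := Convex.norm_image_sub_le_of_norm_hasDerivWithin_le
    (f := fun y => f y - deriv f m * y) (f' := fun y => deriv f y - deriv f m)
    (s := Set.uIcc m x) (C := |x - m|) (x := m) (y := x)
    (fun y _ => by
      simpa using ((hf y).hasDerivAt.fun_sub ((hasDerivAt_id y).const_mul (deriv f m))).hasDerivWithinAt)
    (fun y hy => by
      rw [Real.norm_eq_abs]
      exact (hf' y m).trans (Set.abs_sub_left_of_mem_uIcc hy))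
    (convex_uIcc m x) Set.left_mem_uIcc Set.right_mem_uIcc
  rw [Real.norm_eq_abs, Real.norm_eq_abs, ← sq, sq_abs] at h
  convert h using 2
  ring

/-- A function with `1`-Lipschitz derivative is moved by at most the variance when a random variable
is replaced by its mean. -/
lemma abs_integral_sub_apply_le_variance {μ : Measure ℝ} [IsProbabilityMeasure μ] {f : ℝ → ℝ}
    {m : ℝ} (hf : Differentiable ℝ f) (hf' : ∀ x y, |deriv f x - deriv f y| ≤ |x - y|)
    (hfi : Integrable f μ) (h1 : Integrable (fun x => x) μ) (h2 : Integrable (fun x => x ^ 2) μ)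
    (hm : ∫ x, x ∂μ = m) :
    |∫ x, f x ∂μ - f m| ≤ ∫ x, (x - m) ^ 2 ∂μ := by
  have hc : ∀ c : ℝ, Integrable (fun _ : ℝ => c) μ := integrable_const
  -- The linear term integrates to zero because `m` is the mean.
  have heq : ∫ x, f x ∂μ - f m = ∫ x, (f x - f m - deriv f m * (x - m)) ∂μ := by
    have h3 : Integrable (fun x => f x - f m) μ := hfi.sub (hc _)
    have h4 : Integrable (fun x => x - m) μ := h1.sub (hc m)
    rw [integral_sub h3 (h4.const_mul _), integral_sub hfi (hc _),
      integral_const_mul, integral_sub h1 (hc m), hm]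
    simp
  have hsq : Integrable (fun x => (x - m) ^ 2) μ := by
    have h : ∀ x : ℝ, (x - m) ^ 2 = x ^ 2 - 2 * m * x + m ^ 2 := fun x => by ring
    simp_rw [h]
    exact (h2.sub (h1.const_mul _)).add (hc _)
  rw [heq, ← Real.norm_eq_abs]
  refine norm_integral_le_of_norm_le hsq (ae_of_all _ fun x => ?_)
  rw [Real.norm_eq_abs]
  exact abs_sub_sub_deriv_mul_le hf hf' m x

lemma integrable_of_lipschitz {μ : Measure ℝ} [IsFiniteMeasure μ] {f : ℝ → ℝ} {K : ℝ}
    (hf : Continuous f) (hK : ∀ x y, |f x - f y| ≤ K * |x - y|)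
    (h1 : Integrable (fun x : ℝ => x) μ) : Integrable f μ := by
  refine ((integrable_const |f 0|).add (h1.abs.const_mul K)).mono' hf.aestronglyMeasurable
    (ae_of_all _ fun x => ?_)
  have h := hK x 0
  rw [sub_zero] at h
  have h2 := abs_sub_abs_le_abs_sub (f x) (f 0)
  rw [Real.norm_eq_abs]
  change |f x| ≤ |f 0| + K * |x|
  linarith

lemma abs_gumbelToMax_le {n : ℕ} (hn : n ≠ 0) (z : ℝ) :
    |gumbelToMax n z| ≤ Real.exp (-z) + |z| + Real.log n := by
  have h1 : (1 : ℝ) ≤ n := by exact_mod_cast Nat.one_le_iff_ne_zero.2 hn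
  have h2 := abs_gumbelToMax_sub_le hn z
  have h3 := div_le_self (Real.exp_pos (-z)).le h1
  have h4 := Real.log_nonneg h1
  rw [abs_le] at h2 ⊢
  have h5 := neg_abs_le z
  have h6 := le_abs_self z
  constructor <;> linarith

/-! ### The two comparisons. -/

section Poissonized

variable {n : ℕ}

lemma integrable_gumbelToMax (hn : n ≠ 0) : Integrable (gumbelToMax n) gumbel :=
  ((integrable_exp_neg_gumbel.add integrable_id_gumbel.abs).add (integrable_const _)).mono'
    (measurable_gumbelToMax n).aestronglyMeasurable (ae_of_all _ fun z => abs_gumbelToMax_le hn z)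

lemma isFiniteMeasure_poissonizedLaw (hn : n ≠ 0) (hq : ∀ k, 0 ≤ completionProb n k) :
    IsFiniteMeasure (poissonizedLaw n) := by
  rw [← map_gumbelToMax hn hq]
  infer_instance

lemma integrable_id_poissonizedLaw (hn : n ≠ 0) (hq : ∀ k, 0 ≤ completionProb n k) :
    Integrable (fun x : ℝ => x) (poissonizedLaw n) := by
  rw [← map_gumbelToMax hn hq, integrable_map_measure continuous_id'.aestronglyMeasurable
    (measurable_gumbelToMax n).aemeasurable]
  exact integrable_gumbelToMax hn

/-- The coupling bounds the mean of the completion time by a constant plus a multiple of `log n`,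
without harmonic sums. -/
lemma integral_id_poissonizedLaw_le (hn : n ≠ 0) (hq : ∀ k, 0 ≤ completionProb n k) :
    ∫ x, x ∂poissonizedLaw n ≤ ∫ z, Real.exp (-z) ∂gumbel + ∫ z, |z| ∂gumbel +
      gumbel.real Set.univ * Real.log n := by
  rw [← map_gumbelToMax hn hq, integral_map (measurable_gumbelToMax n).aemeasurable
    continuous_id'.aestronglyMeasurable]
  have hi : Integrable (fun z => Real.exp (-z) + |z|) gumbel :=
    integrable_exp_neg_gumbel.add integrable_id_gumbel.abs
  calc ∫ z, gumbelToMax n z ∂gumbel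
      ≤ ∫ z, (Real.exp (-z) + |z| + Real.log n) ∂gumbel :=
        integral_mono (integrable_gumbelToMax hn) (hi.add (integrable_const _)) fun z =>
          (le_abs_self _).trans (abs_gumbelToMax_le hn z)
    _ = _ := by
        rw [integral_add hi (integrable_const _),
          integral_add integrable_exp_neg_gumbel integrable_id_gumbel.abs, integral_const,
          smul_eq_mul]

lemma hasSum_integral_poissonizedLaw (hq : ∀ k, 0 ≤ completionProb n k) {g : ℝ → ℝ}
    (hg : Integrable g (poissonizedLaw n)) :
    HasSum (fun k : ℕ => completionProb n k * ∫ x, g x ∂gammaMeasure ((k : ℝ) + 1) n)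
      (∫ x, g x ∂poissonizedLaw n) := by
  have h := hasSum_integral_measure hg
  simp only [integral_smul_measure, ENNReal.toReal_ofReal (hq _), smul_eq_mul] at h
  exact h

lemma hasSum_mean_poissonizedLaw (hn : n ≠ 0) (hq : ∀ k, 0 ≤ completionProb n k) :
    HasSum (fun k : ℕ => completionProb n k * (((k : ℝ) + 1) / n))
      (∫ x, x ∂poissonizedLaw n) := by
  have hn0 : (0 : ℝ) < n := Nat.cast_pos.2 (Nat.pos_of_ne_zero hn)
  have h := hasSum_integral_poissonizedLaw hq (integrable_id_poissonizedLaw hn hq)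
  have hm : ∀ k : ℕ, ∫ x, x ∂gammaMeasure ((k : ℝ) + 1) n = ((k : ℝ) + 1) / n := fun k =>
    integral_id_gammaMeasure (by positivity) hn0
  simpa only [hm] using h

lemma abs_integral_poissonizedLaw_sub_le (hn : n ≠ 0) (hq : ∀ k, 0 ≤ completionProb n k)
    {f : ℝ → ℝ} (hf : Continuous f) (hlip : ∀ x y, |f x - f y| ≤ |x - y|) :
    |∫ x, f (x - Real.log n) ∂poissonizedLaw n - ∫ z, f z ∂gumbel| ≤
      (∫ z, Real.exp (-z) ∂gumbel) / n := by
  have hfs : Continuous fun x => f (x - Real.log n) := by fun_prop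
  have hlip1 : ∀ x y, |f x - f y| ≤ 1 * |x - y| := by simpa using hlip
  rw [← map_gumbelToMax hn hq, integral_map (measurable_gumbelToMax n).aemeasurable
    hfs.aestronglyMeasurable]
  have hi2 := integrable_of_lipschitz hf hlip1 integrable_id_gumbel
  have hi1 : Integrable (fun z => f (gumbelToMax n z - Real.log n)) gumbel := by
    have := isFiniteMeasure_poissonizedLaw hn hq
    have h := integrable_of_lipschitz (μ := poissonizedLaw n) hfs (K := 1)
      (fun x y => by simpa using hlip (x - Real.log n) (y - Real.log n))
      (integrable_id_poissonizedLaw hn hq)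
    rw [← map_gumbelToMax hn hq, integrable_map_measure hfs.aestronglyMeasurable
      (measurable_gumbelToMax n).aemeasurable] at h
    exact h
  rw [← integral_sub hi1 hi2, ← Real.norm_eq_abs, ← integral_div]
  refine norm_integral_le_of_norm_le (integrable_exp_neg_gumbel.div_const _)
    (ae_of_all _ fun z => ?_)
  exact (hlip _ _).trans (abs_gumbelToMax_sub_le hn z)

/-- The law of the normalized completion time, as a mixture of point masses. -/
noncomputable def normalizedLaw (n : ℕ) : Measure ℝ :=
  Measure.sum fun k : ℕ =>
    ENNReal.ofReal (completionProb n k) • Measure.dirac (((k : ℝ) + 1) / n - Real.log n)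

lemma integrable_id_normalizedLaw [IsFiniteMeasure (normalizedLaw n)] (hn : n ≠ 0)
    (hq : ∀ k, 0 ≤ completionProb n k) : Integrable (fun x : ℝ => x) (normalizedLaw n) := by
  -- After the shift all atoms are positive, so absolute summability is that of the series for the
  -- Poissonized mean.
  have h : Integrable (fun x : ℝ => x + Real.log n) (normalizedLaw n) := by
    refine integrable_sum_dirac (fun _ => ENNReal.ofReal_ne_top) ?_
    refine (hasSum_mean_poissonizedLaw hn hq).summable.congr fun k => ?_
    rw [ENNReal.toReal_ofReal (hq k), sub_add_cancel, Real.norm_of_nonneg (by positivity)]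
  have h' : Integrable (fun x : ℝ => x + Real.log n - Real.log n) (normalizedLaw n) :=
    h.sub (integrable_const _)
  simpa using h'

lemma hasSum_integral_normalizedLaw (hq : ∀ k, 0 ≤ completionProb n k) {g : ℝ → ℝ}
    (hg : Integrable g (normalizedLaw n)) :
    HasSum (fun k : ℕ => completionProb n k * g (((k : ℝ) + 1) / n - Real.log n))
      (∫ x, g x ∂normalizedLaw n) := by
  have h := hasSum_integral_measure hg
  simp only [integral_smul_measure, ENNReal.toReal_ofReal (hq _), smul_eq_mul,
    integral_dirac] at h
  exact h

/-- Each atom is the mean of the matching shifted Gamma law, so the variance bound applies term by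
term; the variances `((k + 1) / n) / n` average to the right-hand side. -/
lemma abs_integral_normalizedLaw_sub_le [IsFiniteMeasure (normalizedLaw n)] (hn : n ≠ 0)
    (hq : ∀ k, 0 ≤ completionProb n k)
    {f : ℝ → ℝ} (hf : Differentiable ℝ f) (hlip : ∀ x y, |f x - f y| ≤ |x - y|)
    (hlip' : ∀ x y, |deriv f x - deriv f y| ≤ |x - y|) :
    |∫ x, f x ∂normalizedLaw n - ∫ x, f (x - Real.log n) ∂poissonizedLaw n| ≤
      (∫ x, x ∂poissonizedLaw n) / n := by
  have hn0 : (0 : ℝ) < n := Nat.cast_pos.2 (Nat.pos_of_ne_zero hn)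
  have := isFiniteMeasure_poissonizedLaw hn hq
  set g : ℝ → ℝ := fun x => f (x - Real.log n) with hg
  have hgd : Differentiable ℝ g := by
    rw [hg]
    fun_prop
  have hglip : ∀ x y, |g x - g y| ≤ 1 * |x - y| := fun x y => by
    simpa [hg] using hlip (x - Real.log n) (y - Real.log n)
  have hglip' : ∀ x y, |deriv g x - deriv g y| ≤ |x - y| := fun x y => by
    simp only [hg, deriv_comp_sub_const]
    simpa using hlip' (x - Real.log n) (y - Real.log n)
  have h1 := hasSum_integral_normalizedLaw hq (integrable_of_lipschitz hf.continuous (K := 1)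
    (by simpa using hlip) (integrable_id_normalizedLaw hn hq))
  have h2 := hasSum_integral_poissonizedLaw hq (integrable_of_lipschitz hgd.continuous hglip
    (integrable_id_poissonizedLaw hn hq))
  have h3 := (hasSum_mean_poissonizedLaw hn hq).div_const (n : ℝ)
  have hle : ∀ k : ℕ, ‖completionProb n k * f (((k : ℝ) + 1) / n - Real.log n) -
      completionProb n k * ∫ x, g x ∂gammaMeasure ((k : ℝ) + 1) n‖ ≤
      completionProb n k * (((k : ℝ) + 1) / n) / n := by
    intro k
    have hk : (0 : ℝ) < (k : ℝ) + 1 := by positivity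
    have := isProbabilityMeasure_gammaMeasure hk hn0
    have hi := integrable_id_gammaMeasure hk hn0
    have h := abs_integral_sub_apply_le_variance hgd hglip'
      (integrable_of_lipschitz hgd.continuous hglip hi) hi
      (integrable_pow_gammaMeasure hk hn0 2) (integral_id_gammaMeasure hk hn0)
    rw [integral_sub_mean_sq_gammaMeasure hk hn0, abs_sub_comm] at h
    rw [← mul_sub, norm_mul, Real.norm_of_nonneg (hq k), Real.norm_eq_abs, mul_div_assoc]
    refine mul_le_mul_of_nonneg_left (h.trans_eq ?_) (hq k)
    rw [sq, div_div]
  rw [← (h1.sub h2).tsum_eq, ← Real.norm_eq_abs]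
  exact tsum_of_norm_bounded h3 hle

end Poissonized

end CouponCollector

/-! ### Assembling the bound. -/

open CouponCollector

theorem theorem3p1 :
    ∃ C : ℝ, 0 < C ∧ ∀ n : ℕ, 2 ≤ n →
      ∀ {Ω : Type*} [MeasurableSpace Ω] (P : Measure Ω) [IsProbabilityMeasure P]
        (X : ℕ → Ω → Fin n), (∀ i, Measurable (X i)) → iIndepFun X P →
        (∀ i, P.map (X i) = uniformOn Set.univ) →
        (∀ᵐ ω ∂P, ∃ k, 1 ≤ k ∧ CouponCollector.Collected (fun i => X i ω) k) ∧
        (∀ f : ℝ → ℝ, CouponCollector.MemLipTwo f →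
          Integrable f (P.map (CouponCollector.normalizedTime X)) ∧
          Integrable f CouponCollector.gumbel) ∧
        CouponCollector.lipTwoDist (P.map (CouponCollector.normalizedTime X))
            CouponCollector.gumbel ≤
          ((C * (Real.log n / n) : ℝ) : EReal) := by
  set A := ∫ z, Real.exp (-z) ∂gumbel
  set B := ∫ z, |z| ∂gumbel
  set M := gumbel.real Set.univ
  have hA0 : 0 ≤ A := integral_nonneg fun z => (Real.exp_pos _).le
  have hB0 : 0 ≤ B := integral_nonneg fun z => abs_nonneg z
  have hM0 : 0 ≤ M := measureReal_nonneg
  have hlog2 : 0 < Real.log 2 := Real.log_pos one_lt_two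
  -- The coupling contributes `A` and the mean bound `A + B + M * log n`. Since `log 2 ≤ log n`,
  -- dividing `2 * A + B` by `log 2` absorbs it into the logarithm; the `1` makes the constant
  -- positive.
  refine ⟨(2 * A + B) / Real.log 2 + M + 1, by positivity, ?_⟩
  intro n hn Ω _ P _ X hX hind hunif
  have hn' : n ≠ 0 := by omega
  have : NeZero n := ⟨hn'⟩
  have hn0 : (0 : ℝ) < n := Nat.cast_pos.2 (Nat.pos_of_ne_zero hn')
  have hq := completionProb_nonneg hX hind hunif
  have hlaw : P.map (normalizedTime X) = normalizedLaw n := map_normalizedTime hX hind hunif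
  have : IsFiniteMeasure (normalizedLaw n) := by
    rw [← hlaw]
    infer_instance
  rw [hlaw]
  refine ⟨ae_exists_collected hX hind hunif, fun f hf => ?_, ?_⟩
  · have hlip := abs_sub_le_of_lipSeminorm_le ENNReal.toReal_nonneg
      (ENNReal.ofReal_toReal hf.lip.ne).ge
    exact ⟨integrable_of_lipschitz hf.differentiable.continuous hlip
        (integrable_id_normalizedLaw hn' hq),
      integrable_of_lipschitz hf.differentiable.continuous hlip integrable_id_gumbel⟩
  · refine iSup_le fun f => iSup_le fun hf => iSup_le fun hf1 => ?_
    rw [EReal.coe_le_coe_iff]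
    have hlip : ∀ x y, |f x - f y| ≤ |x - y| := by
      have := abs_sub_le_of_lipSeminorm_le zero_le_one
        ((le_max_left _ (lipSeminorm (deriv f))).trans (hf1.le.trans_eq ENNReal.ofReal_one.symm))
      simpa using this
    have hlip' : ∀ x y, |deriv f x - deriv f y| ≤ |x - y| := by
      have := abs_sub_le_of_lipSeminorm_le zero_le_one
        ((le_max_right (lipSeminorm f) _).trans (hf1.le.trans_eq ENNReal.ofReal_one.symm))
      simpa using this
    have h1 := (le_abs_self _).trans
      (abs_integral_normalizedLaw_sub_le hn' hq hf.differentiable hlip hlip')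
    have h2 := (le_abs_self _).trans
      (abs_integral_poissonizedLaw_sub_le hn' hq hf.differentiable.continuous hlip)
    have h3 := integral_id_poissonizedLaw_le hn' hq
    have hlog : Real.log 2 ≤ Real.log n :=
      Real.log_le_log two_pos (by exact_mod_cast hn)
    have h4 : 2 * A + B ≤ (2 * A + B) / Real.log 2 * Real.log n := by
      rw [div_mul_eq_mul_div, le_div_iff₀ hlog2]
      exact mul_le_mul_of_nonneg_left hlog (by positivity)
    calc ∫ x, f x ∂normalizedLaw n - ∫ x, f x ∂gumbel
        ≤ (∫ x, x ∂poissonizedLaw n) / n + A / n := by linarith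
      _ = (∫ x, x ∂poissonizedLaw n + A) / n := by rw [add_div]
      _ ≤ (((2 * A + B) / Real.log 2 + M + 1) * Real.log n) / n := by
          refine div_le_div_of_nonneg_right ?_ hn0.le
          linarith
      _ = ((2 * A + B) / Real.log 2 + M + 1) * (Real.log n / n) := mul_div_assoc _ _ _
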